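/- **Setting.** Let $G$ be a compact topological group (for instance a compact matrix Lie group) with identity $I_d$, whose topology is given by a right-invariant distance $d$; write $\mathcal B_o(x,r)$ for the open $d$-balls and $\mu$ for a Haar measure. Let $\mathcal Y$ be a measurable space with a measurable left action of $G$, let $h:G\times\mathbb R^p\to\mathcal Y$ and $K:\mathcal Y\to G$ be measurable with $K(h(I_d,0))=I_d$ and $g\mapsto K(h(g,0))$ continuous, and let $\Upsilon\in G$. Fix a probability law $\nu_W$ on $G$ and a probability law $\nu_V$ on $\mathbb R^p$. Assume that $h$ is left-right equivariant: for all $g,\chi\in G$ and $V\sim\nu_V$, $h(\chi g,V)\overset{\mathcal L}{=}g^{-1}h(\chi,V)$ and $h(\chi g,0)=g^{-1}h(\chi,0)$. Consider the system and the filter $$\chi_{n+1}=\Upsilon W_n\chi_n\Omega_n,\quad Y_n=h(\chi_n,V_n),\qquad \hat\chi'_{n+1}=\Upsilon\hat\chi_n\Omega_n,\quad \hat\chi_{n+1}=K(\hat\chi'_{n+1}Y_{n+1})\,\hat\chi'_{n+1}\qquad(n\ge 0),$$ with deterministic inputs $\Omega_n\in G$, where the noises $W_n\sim\nu_W$ and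 $V_{n+1}\sim\nu_V$ $(n\ge0)$ are mutually independent and independent of $(\chi_0,\hat\chi_0)$, and the error $\eta_n=\chi_n\hat\chi_n^{-1}$. By equivariance $(\eta_n)$ is a homogeneous Markov chain with transition $$x\mapsto x'\,K(h(x',V))^{-1},\quad x'=\Upsilon Wx\Upsilon^{-1},\qquad W\sim\nu_W,\ V\sim\nu_V\ \text{independent}.$$ **Assumptions.** For some $\alpha>0$: 1. (Diffusivity) there is $\epsilon>0$ such that $\nu_W(U)\ge\epsilon\,\mu(U)$ for every measurable $U\subset\mathcal B_o(I_d,\alpha)$; 2. (Reasonable output noise) for every $g\in G$ there is $\epsilon'>0$ with $\mathbb P\big[gK(h(g,V))^{-1}\in\mathcal B_o\big(gK(h(g,0))^{-1},\tfrac{\alpha}{2}\big)\big]>\epsilon'$, where $V\sim\nu_V$; 3. (Almost global convergence without noise) for $\mu$-almost every $\gamma_0\in G$ the sequence $\gamma'_{n+1}=\Upsilon\gamma_n\Upsilon^{-1}$, $\gamma_{n+1}=\gamma'_{n+1}K(h(\gamma'_{n+1},0))^{-1}$ converges to $I_d$. **Conclusion.** The error chain has a unique stationary probability distribution $\pi$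 on $G$, and, for any prior law of the error $\eta_0$ (and any inputs $\Omega_n$), the law $\mu_n$ of $\eta_n$ satisfies $\lim_{n\to\infty}\|\mu_n-\pi\|_{T.V.}=0$. -/

import Mathlib

open MeasureTheory ProbabilityTheory Filter Topology
open scoped ENNReal

namespace InvariantFilter

/-- Total variation norm of the signed measure `μ - ν`. -/
noncomputable def tvNorm {X : Type*} [MeasurableSpace X] (μ ν : Measure X)
    [IsFiniteMeasure μ] [IsFiniteMeasure ν] : ℝ≥0∞ :=
  (μ.toSignedMeasure - ν.toSignedMeasure).totalVariation Set.univ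

section

variable {G Y : Type*} [Group G] {p : ℕ}

/-- Left-right equivariance of the output map `h`, for an output noise of law `νV`:
`h (χ g, V)` and `g⁻¹ h (χ, V)` have the same law, and `h (χ g, 0) = g⁻¹ h (χ, 0)`. -/
def LeftRightEquivariant [MeasurableSpace Y] [MulAction G Y]
    (h : G → EuclideanSpace ℝ (Fin p) → Y) (νV : Measure (EuclideanSpace ℝ (Fin p))) : Prop :=
  ∀ g χ : G,
    νV.map (fun v => h (χ * g) v) = νV.map (fun v => g⁻¹ • h χ v) ∧
    h (χ * g) 0 = g⁻¹ • h χ 0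

/-- Diffusivity: on the ball of radius `α` around the identity, the law `νW` of the process noise
dominates a positive multiple of the Haar measure `μ`. -/
def Diffusive [MetricSpace G] [MeasurableSpace G] (μ νW : Measure G) (α : ℝ) : Prop :=
  ∃ ε : ℝ, 0 < ε ∧ ∀ U : Set G, MeasurableSet U → U ⊆ Metric.ball 1 α →
    ε * μ.real U ≤ νW.real U

/-- Reasonable output noise: for every `g`, the noisy update of `g` is within distance `α / 2` of
the noise-free update of `g` with positive probability. -/
def ReasonableOutputNoise [MetricSpace G] (h : G → EuclideanSpace ℝ (Fin p) → Y) (K : Y → G)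
    (νV : Measure (EuclideanSpace ℝ (Fin p))) (α : ℝ) : Prop :=
  ∀ g : G, ∃ ε' : ℝ, 0 < ε' ∧
    ε' < νV.real {v | g * (K (h g v))⁻¹ ∈ Metric.ball (g * (K (h g 0))⁻¹) (α / 2)}

/-- One step of the error equation, with process noise `w` and output noise `v`:
`x' = Υ w x Υ⁻¹`, followed by `x' K(h(x', v))⁻¹`. -/
def errorStep (h : G → EuclideanSpace ℝ (Fin p) → Y) (K : Y → G) (Υ : G)
    (w : G) (v : EuclideanSpace ℝ (Fin p)) (x : G) : G :=
  (Υ * w * x * Υ⁻¹) * (K (h (Υ * w * x * Υ⁻¹) v))⁻¹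

/-- `π` is a stationary law of the Markov chain `x ↦ errorStep h K Υ W V x`, in which `W` of law
`νW` and `V` of law `νV` are independent of each other and of `x`. -/
def IsStationary [MeasurableSpace G] (h : G → EuclideanSpace ℝ (Fin p) → Y) (K : Y → G) (Υ : G)
    (νW : Measure G) (νV : Measure (EuclideanSpace ℝ (Fin p))) (π : Measure G) : Prop :=
  (π.prod (νW.prod νV)).map
    (fun z : G × (G × EuclideanSpace ℝ (Fin p)) => errorStep h K Υ z.2.1 z.2.2 z.1) = π

/-- A run, on a probability space `(S, P)`, of the system
`χ (n+1) = Υ (W n) (χ n) (Ωin n)`, `Y n = h (χ n) (V n)` together with the constant-gain filter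
`χpred (n+1) = Υ (χhat n) (Ωin n)`, `χhat (n+1) = K (χpred (n+1) • Y (n+1)) (χpred (n+1))`.
The noises that drive it, `W n` and `V (n+1)` for `n ≥ 0`, are mutually independent of laws `νW`
and `νV`, and independent of the initial pair of state and estimate. -/
structure IsFilterRun [MeasurableSpace G] [MulAction G Y]
    (h : G → EuclideanSpace ℝ (Fin p) → Y) (K : Y → G) (Υ : G) (Ωin : ℕ → G)
    (νW : Measure G) (νV : Measure (EuclideanSpace ℝ (Fin p)))
    {S : Type*} [MeasurableSpace S] (P : Measure S)
    (W : ℕ → S → G) (V : ℕ → S → EuclideanSpace ℝ (Fin p))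
    (χ : ℕ → S → G) (Yobs : ℕ → S → Y) (χpred χhat : ℕ → S → G) : Prop where
  measurable_W : ∀ n, Measurable (W n)
  measurable_V : ∀ n, Measurable (V n)
  measurable_state : Measurable (χ 0)
  measurable_estimate : Measurable (χhat 0)
  noise_law : ∀ n, P.map (fun s => (W n s, V (n + 1) s)) = νW.prod νV
  noise_indep : iIndepFun (fun (n : ℕ) (s : S) => (W n s, V (n + 1) s)) P
  init_indep : IndepFun (fun s => (χ 0 s, χhat 0 s))
    (fun (s : S) (n : ℕ) => (W n s, V (n + 1) s)) P
  state_eq : ∀ n s, χ (n + 1) s = Υ * W n s * χ n s * Ωin n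
  output_eq : ∀ n s, Yobs n s = h (χ n s) (V n s)
  prediction_eq : ∀ n s, χpred (n + 1) s = Υ * χhat n s * Ωin n
  update_eq : ∀ n s,
    χhat (n + 1) s = K (χpred (n + 1) s • Yobs (n + 1) s) * χpred (n + 1) s

end

end InvariantFilter

/-! The proof is a Doeblin argument. The error kernel factors as `E ∘ₖ D`: `D` multiplies by the
process noise and `E` applies the noisy update. Let `T` be the noise-free update, a continuous map
fixing `1` whose iterates converge to `1` almost everywhere. An update falls within `α / 2` of its
noise-free value with positive probability, and the next diffusion covers the ball of radius `α`
around where it fell. That ball contains the one of radius `α / 2` around the noise-free value, so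
the chain can follow any orbit of `T`. A first diffusion charges the points whose orbits tend to
`1`. Compactness makes the time and the probability of coming near `1` uniform in the starting
point, and one more diffusion leaves a multiple of Haar measure on a fixed ball. Hence some power of
the kernel dominates a nonzero measure `ν` (`exists_minorization`). Every block of steps then shares
the part `ν` whatever the initial law, so two laws differ only by a mass decaying geometrically
(`exists_common_part`, `doeblin`). Equivariance enters only in `map_pairStep_error`: it makes the
law of the error evolve on its own, whatever the inputs. -/

namespace InvariantFilter

/-! ### Total variation of measures with a common part -/

/-- The total variation norm of a difference is controlled by the parts that are not common. -/
lemma tvNorm_le_of_eq_add {X : Type*} [MeasurableSpace X] {μ ν a b c : Measure X}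
    [IsFiniteMeasure μ] [IsFiniteMeasure ν] (hμ : μ = a + c) (hν : ν = b + c) :
    tvNorm μ ν ≤ a Set.univ + b Set.univ := by
  have ha : IsFiniteMeasure a := isFiniteMeasure_of_le μ (hμ ▸ Measure.le_add_right le_rfl)
  have hb : IsFiniteMeasure b := isFiniteMeasure_of_le ν (hν ▸ Measure.le_add_right le_rfl)
  have hc : IsFiniteMeasure c := isFiniteMeasure_of_le μ (hμ ▸ Measure.le_add_left le_rfl)
  have hs : μ.toSignedMeasure - ν.toSignedMeasure = a.toSignedMeasure - b.toSignedMeasure := by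
    subst hμ hν
    ext s hs
    simp [Measure.toSignedMeasure_apply_measurable hs]
  unfold tvNorm
  rw [hs]
  -- On a Hahn set `i` the positive part is `a - b`, of mass at most that of `a`; on the complement
  -- the roles are exchanged.
  obtain ⟨i, hi₁, hi₂, hi₃, hpos, hneg⟩ :=
    (a.toSignedMeasure - b.toSignedMeasure).toJordanDecomposition_spec
  rw [SignedMeasure.totalVariation, hpos, hneg, Measure.add_apply]
  refine add_le_add ?_ ?_
  · rw [SignedMeasure.toMeasureOfZeroLE_apply _ hi₂ hi₁ MeasurableSet.univ,
      ← ENNReal.ofReal_eq_coe_nnreal]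
    refine ENNReal.ofReal_le_of_le_toReal ?_
    rw [Set.inter_univ]
    simp only [FunLike.coe_sub, Pi.sub_apply, Measure.toSignedMeasure_apply_measurable hi₁]
    have h1 : a.real i ≤ a.real Set.univ := measureReal_mono (Set.subset_univ _)
    have h2 : 0 ≤ b.real i := measureReal_nonneg
    change a.real i - b.real i ≤ a.real Set.univ
    linarith
  · rw [SignedMeasure.toMeasureOfLEZero_apply _ hi₃ hi₁.compl MeasurableSet.univ,
      ← ENNReal.ofReal_eq_coe_nnreal]
    refine ENNReal.ofReal_le_of_le_toReal ?_
    rw [Set.inter_univ]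
    simp only [FunLike.coe_sub, Pi.sub_apply,
      Measure.toSignedMeasure_apply_measurable hi₁.compl]
    have h1 : b.real iᶜ ≤ b.real Set.univ := measureReal_mono (Set.subset_univ _)
    have h2 : 0 ≤ a.real iᶜ := measureReal_nonneg
    change -(a.real iᶜ - b.real iᶜ) ≤ b.real Set.univ
    linarith

/-! ### Doeblin's theorem -/

section Doeblin

variable {X : Type*} [MeasurableSpace X]

lemma pow_zero_comp_measure (κ : Kernel X X) (μ : Measure X) : (κ ^ 0 : Kernel X X) ∘ₘ μ = μ :=
  Measure.id_comp

lemma pow_succ_comp_measure (κ : Kernel X X) (n : ℕ) (μ : Measure X) :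
    (κ ^ (n + 1)) ∘ₘ μ = (κ ^ n) ∘ₘ (κ ∘ₘ μ) := by
  rw [Measure.comp_assoc, pow_succ]
  rfl

lemma pow_succ_comp_measure' (κ : Kernel X X) (n : ℕ) (μ : Measure X) :
    (κ ^ (n + 1)) ∘ₘ μ = κ ∘ₘ ((κ ^ n) ∘ₘ μ) := by
  rw [Measure.comp_assoc, pow_succ']
  rfl

lemma isMarkovKernel_pow (κ : Kernel X X) [IsMarkovKernel κ] (n : ℕ) : IsMarkovKernel (κ ^ n) := by
  induction n with
  | zero => exact inferInstanceAs (IsMarkovKernel Kernel.id)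
  | succ n ih =>
    rw [pow_succ]
    exact inferInstanceAs (IsMarkovKernel ((κ ^ n) ∘ₖ κ))

lemma invariant_pow {κ : Kernel X X} {π : Measure X} (hπ : κ ∘ₘ π = π) (n : ℕ) :
    (κ ^ n) ∘ₘ π = π := by
  induction n with
  | zero => exact pow_zero_comp_measure κ π
  | succ n ih => rw [pow_succ_comp_measure, hπ, ih]

/-- A Markov kernel that dominates a finite measure `ν` is the sum of a kernel and of `ν`. -/
lemma exists_kernel_eq_add_const (κ : Kernel X X) [IsMarkovKernel κ] (ν : Measure X)
    [IsFiniteMeasure ν] (hν : ∀ x, ν ≤ κ x) :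
    ∃ R : Kernel X X, κ = R + Kernel.const X ν ∧ ∀ x, R x Set.univ = 1 - ν Set.univ := by
  refine ⟨⟨fun x => κ x - ν, ?_⟩, ?_, fun x => ?_⟩
  · refine Measure.measurable_of_measurable_coe _ fun s hs => ?_
    simp_rw [fun x => Measure.sub_apply hs (hν x)]
    exact (κ.measurable_coe hs).sub_const _
  · ext1 x
    exact (Measure.sub_add_cancel_of_le (hν x)).symm
  · change (κ x - ν) Set.univ = _
    rw [Measure.sub_apply MeasurableSet.univ (hν x), measure_univ]

lemma const_comp_measure (ν μ : Measure X) [IsProbabilityMeasure μ] :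
    Kernel.const X ν ∘ₘ μ = ν := by
  simp [Measure.const_comp]

lemma comp_apply_univ_of_const {R : Kernel X X} {r : ℝ≥0∞} (hR : ∀ x, R x Set.univ = r)
    (μ : Measure X) : (R ∘ₘ μ) Set.univ = r * μ Set.univ := by
  rw [Measure.bind_apply MeasurableSet.univ R.aemeasurable]
  simp [hR]

/-- After `k` steps of a Markov kernel that dominates `ν`, the laws started from any two
probability measures agree up to a mass `(1 - ν univ) ^ k`. -/
lemma exists_common_part (κ : Kernel X X) [IsMarkovKernel κ] (ν : Measure X)
    [IsFiniteMeasure ν] (hν : ∀ x, ν ≤ κ x) (k : ℕ) :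
    ∃ c : Measure X, ∀ μ : Measure X, IsProbabilityMeasure μ →
      ∃ a : Measure X, a Set.univ = (1 - ν Set.univ) ^ k ∧ (κ ^ k) ∘ₘ μ = a + c := by
  obtain ⟨R, hκ, hR⟩ := exists_kernel_eq_add_const κ ν hν
  have hp : ∀ (μ : Measure X), IsProbabilityMeasure μ → κ ∘ₘ μ = R ∘ₘ μ + ν := by
    intro μ _
    conv_lhs => rw [hκ]
    rw [Measure.add_comp, const_comp_measure]
  induction k with
  | zero =>
    refine ⟨0, fun μ hμ => ⟨μ, by simp, ?_⟩⟩
    rw [pow_zero_comp_measure, add_zero]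
  | succ k ih =>
    obtain ⟨c, hc⟩ := ih
    -- The constant kernel sends every probability measure to `ν`, so the new common part still does
    -- not depend on `μ`.
    refine ⟨R ∘ₘ c + ν, fun μ hμ => ?_⟩
    obtain ⟨a, ha, hac⟩ := hc μ hμ
    refine ⟨R ∘ₘ a, ?_, ?_⟩
    · rw [comp_apply_univ_of_const hR, ha, pow_succ']
    · have := isMarkovKernel_pow κ k
      rw [pow_succ_comp_measure', hp _ inferInstance, hac, Measure.comp_add, add_assoc]

/-- A Markov kernel that dominates a nonzero finite measure has an invariant probability. -/
lemma exists_invariant_of_le (κ : Kernel X X) [IsMarkovKernel κ] (ν : Measure X)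
    [IsFiniteMeasure ν] (hν : ∀ x, ν ≤ κ x) (hν0 : ν Set.univ ≠ 0) (hν1 : ν Set.univ ≤ 1) :
    ∃ π : Measure X, IsProbabilityMeasure π ∧ κ ∘ₘ π = π := by
  obtain ⟨R, hκ, hR⟩ := exists_kernel_eq_add_const κ ν hν
  -- Invariance reads `π = R π + ν`; its Neumann series `∑ R ^ k ν` is a solution, with a geometric
  -- total mass equal to `1`.
  let m : ℕ → Measure X := fun k => (fun ρ => R ∘ₘ ρ)^[k] ν
  have hm : ∀ k, m k Set.univ = (1 - ν Set.univ) ^ k * ν Set.univ := by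
    intro k
    induction k with
    | zero => simp [m]
    | succ k ih =>
      have : m (k + 1) = R ∘ₘ m k := Function.iterate_succ_apply' _ _ _
      rw [this, comp_apply_univ_of_const hR, ih, pow_succ', mul_assoc]
  have hπ : IsProbabilityMeasure (Measure.sum m) := by
    refine ⟨?_⟩
    rw [Measure.sum_apply _ MeasurableSet.univ]
    simp_rw [hm]
    rw [ENNReal.tsum_mul_right, ENNReal.tsum_geometric,
      ENNReal.sub_sub_cancel ENNReal.one_ne_top hν1]
    exact ENNReal.inv_mul_cancel hν0 (measure_ne_top _ _)
  refine ⟨Measure.sum m, hπ, ?_⟩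
  conv_lhs => rw [hκ]
  rw [Measure.add_comp, const_comp_measure]
  ext s hs
  rw [Measure.add_apply, Measure.bind_apply hs R.aemeasurable, lintegral_sum_measure,
    Measure.sum_apply _ hs, tsum_eq_zero_add' (f := fun i => m i s) ENNReal.summable, add_comm]
  have hk : ∀ k, ∫⁻ x, R x s ∂(m k) = m (k + 1) s := fun k => by
    have : m (k + 1) = R ∘ₘ m k := Function.iterate_succ_apply' _ _ _
    rw [this, Measure.bind_apply hs R.aemeasurable]
  simp_rw [hk]
  rfl

/-- A Markov kernel that dominates a nonzero finite measure has at most one invariant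
probability. -/
lemma invariant_unique_of_le (κ : Kernel X X) [IsMarkovKernel κ] (ν : Measure X)
    [IsFiniteMeasure ν] (hν : ∀ x, ν ≤ κ x) (hν0 : ν Set.univ ≠ 0)
    (π π' : Measure X) (h1 : IsProbabilityMeasure π) (h1' : IsProbabilityMeasure π')
    (hπ : κ ∘ₘ π = π) (hπ' : κ ∘ₘ π' = π') : π = π' := by
  have hr : 1 - ν Set.univ < 1 := ENNReal.sub_lt_self ENNReal.one_ne_top one_ne_zero hν0
  have key : ∀ π π' : Measure X, IsProbabilityMeasure π → IsProbabilityMeasure π' →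
      κ ∘ₘ π = π → κ ∘ₘ π' = π' → ∀ s, π s ≤ π' s := by
    intro π π' h1 h1' hπ hπ' s
    have hk : ∀ k : ℕ, π s ≤ (1 - ν Set.univ) ^ k + π' s := by
      intro k
      obtain ⟨c, hc⟩ := exists_common_part κ ν hν k
      obtain ⟨a, ha, hac⟩ := hc π h1
      obtain ⟨b, -, hbc⟩ := hc π' h1'
      rw [invariant_pow hπ] at hac
      rw [invariant_pow hπ'] at hbc
      calc π s = a s + c s := by rw [hac, Measure.add_apply]
        _ ≤ (1 - ν Set.univ) ^ k + π' s := by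
          refine add_le_add (ha ▸ measure_mono (Set.subset_univ s)) ?_
          rw [hbc, Measure.add_apply]
          exact le_add_self
    have hlim : Tendsto (fun k : ℕ => (1 - ν Set.univ) ^ k + π' s) atTop (𝓝 (0 + π' s)) :=
      (ENNReal.tendsto_pow_atTop_nhds_zero_of_lt_one hr).add tendsto_const_nhds
    rw [zero_add (π' s)] at hlim
    exact ge_of_tendsto' hlim hk
  ext s _
  exact le_antisymm (key π π' h1 h1' hπ hπ' s) (key π' π h1' h1 hπ' hπ s)

/-- **Doeblin's theorem**: if a power of a Markov kernel dominates a nonzero measure, then the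
kernel has a unique invariant probability, to which the laws of the chain converge in total
variation. -/
theorem doeblin (κ : Kernel X X) [IsMarkovKernel κ] {N : ℕ} (hN : N ≠ 0) (ν : Measure X)
    [IsFiniteMeasure ν] (hν : ∀ x, ν ≤ (κ ^ N) x) (hν0 : ν Set.univ ≠ 0)
    (hν1 : ν Set.univ ≤ 1) :
    ∃ π : Measure X, ∃ _ : IsProbabilityMeasure π, κ ∘ₘ π = π ∧
      (∀ π' : Measure X, IsProbabilityMeasure π' → κ ∘ₘ π' = π' → π' = π) ∧
      ∀ (m : ℕ → Measure X) [∀ n, IsProbabilityMeasure (m n)], (∀ n, m (n + 1) = κ ∘ₘ m n) →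
        Tendsto (fun n => tvNorm (m n) π) atTop (𝓝 0) := by
  have hM := isMarkovKernel_pow κ N
  obtain ⟨π, h1, hπ⟩ := exists_invariant_of_le (κ ^ N) ν hν hν0 hν1
  have hinv : κ ∘ₘ π = π := by
    -- `κ ∘ₘ π` is also invariant under `κ ^ N`, so uniqueness for the power identifies it with `π`.
    refine invariant_unique_of_le (κ ^ N) ν hν hν0 _ _ inferInstance h1 ?_ hπ
    rw [← pow_succ_comp_measure, pow_succ_comp_measure', hπ]
  refine ⟨π, h1, hinv, fun π' h1' hπ' => ?_, fun m _ hm => ?_⟩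
  · exact invariant_unique_of_le (κ ^ N) ν hν hν0 _ _ h1' h1 (invariant_pow hπ' N) hπ
  have hr : 1 - ν Set.univ < 1 := ENNReal.sub_lt_self ENNReal.one_ne_top one_ne_zero hν0
  have hstep : ∀ k j, m (j + k) = (κ ^ k) ∘ₘ m j := by
    intro k j
    induction k with
    | zero => exact (pow_zero_comp_measure κ (m j)).symm
    | succ k ih => rw [← add_assoc, hm, ih, pow_succ_comp_measure']
  have hbound : ∀ n, tvNorm (m n) π ≤ 2 * (1 - ν Set.univ) ^ (n / N) := by
    intro n
    -- The law at time `n` is that at time `n % N` moved by `n / N` blocks of `N` steps; the bound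
    -- is uniform in the law at time `n % N`.
    obtain ⟨c, hc⟩ := exists_common_part (κ ^ N) ν hν (n / N)
    obtain ⟨a, ha, hac⟩ := hc (m (n % N)) inferInstance
    obtain ⟨b, hb, hbc⟩ := hc π h1
    rw [← pow_mul, ← hstep, Nat.mod_add_div] at hac
    rw [invariant_pow hπ] at hbc
    refine (tvNorm_le_of_eq_add hac hbc).trans ?_
    rw [ha, hb, two_mul]
  have hlim : Tendsto (fun n : ℕ => 2 * (1 - ν Set.univ) ^ (n / N)) atTop (𝓝 0) := by
    have := ENNReal.Tendsto.const_mul (a := 2) ((ENNReal.tendsto_pow_atTop_nhds_zero_of_lt_one hr).comp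
      (Nat.tendsto_div_const_atTop hN)) (Or.inr (by simp))
    simpa using this
  exact tendsto_of_tendsto_of_tendsto_of_le_of_le tendsto_const_nhds hlim (fun _ => zero_le)
    hbound

end Doeblin

/-! ### Minorization from diffusion and almost global convergence -/

/-- The measure of the trace of a set on a ball is lower semicontinuous in the centre. -/
lemma isOpen_setOf_measure_inter_ball_ne_zero {X : Type*} [MetricSpace X]
    [MeasurableSpace X] (μ : Measure X) (A : Set X) (r : ℝ) :
    IsOpen {c : X | μ (A ∩ Metric.ball c r) ≠ 0} := by
  rw [Metric.isOpen_iff]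
  intro c hc
  -- Some slightly smaller concentric ball already meets `A` in positive measure, and it stays
  -- inside the ball of radius `r` when the centre moves by less than the lost radius.
  have hU : A ∩ Metric.ball c r = ⋃ k : ℕ, A ∩ Metric.ball c (r - 1 / ((k : ℝ) + 1)) := by
    ext y
    simp only [Set.mem_inter_iff, Metric.mem_ball, Set.mem_iUnion]
    constructor
    · rintro ⟨hy, hd⟩
      obtain ⟨k, hk⟩ := exists_nat_one_div_lt (sub_pos.2 hd)
      exact ⟨k, hy, by linarith⟩
    · rintro ⟨k, hy, hd⟩
      have : (0 : ℝ) < 1 / ((k : ℝ) + 1) := Nat.one_div_pos_of_nat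
      exact ⟨hy, by linarith⟩
  have hex : ∃ k : ℕ, μ (A ∩ Metric.ball c (r - 1 / ((k : ℝ) + 1))) ≠ 0 := by
    by_contra! hcon
    exact hc (by rw [hU]; exact measure_iUnion_null hcon)
  obtain ⟨k, hk⟩ := hex
  refine ⟨1 / ((k : ℝ) + 1), Nat.one_div_pos_of_nat, fun c' hc' h0 => hk ?_⟩
  refine measure_mono_null (Set.inter_subset_inter_right A ?_) h0
  refine Metric.ball_subset_ball' ?_
  rw [dist_comm]
  linarith [Metric.mem_ball.1 hc']

lemma le_lintegral_of_subset {Z : Type*} [MeasurableSpace Z] {μ : Measure Z} {S : Set Z}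
    (hS : MeasurableSet S) {f : Z → ℝ≥0∞} {c : ℝ≥0∞} (h : ∀ z ∈ S, c ≤ f z) :
    c * μ S ≤ ∫⁻ z, f z ∂μ :=
  calc c * μ S = ∫⁻ _ in S, c ∂μ := by simp
    _ ≤ ∫⁻ z in S, f z ∂μ := setLIntegral_mono' hS h
    _ ≤ ∫⁻ z, f z ∂μ := setLIntegral_le_lintegral _ _

lemma lintegral_ne_zero_of_subset {Z : Type*} [MeasurableSpace Z] {μ : Measure Z} {S : Set Z}
    {f : Z → ℝ≥0∞} (hf : Measurable f) (hS : μ S ≠ 0) (h : ∀ z ∈ S, f z ≠ 0) :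
    ∫⁻ z, f z ∂μ ≠ 0 := by
  intro h0
  rw [lintegral_eq_zero_iff hf] at h0
  exact hS (measure_mono_null (fun z hz => h z hz) (ae_iff.1 h0))

/-- Reaching arguments are easier for `D ∘ₖ E`, where each step ends with a diffusion; this
regrouping carries them over to `E ∘ₖ D`. -/
lemma comp_pow_succ {X : Type*} [MeasurableSpace X] (D E : Kernel X X) (n : ℕ) :
    (E ∘ₖ D) ^ (n + 1) = E ∘ₖ (((D ∘ₖ E) ^ n) ∘ₖ D) := by
  change (E * D) ^ (n + 1) = E * ((D * E) ^ n * D)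
  induction n with
  | zero => simp
  | succ n ih => rw [pow_succ', ih, pow_succ']; simp only [mul_assoc]

lemma comp_measure_mono {X : Type*} [MeasurableSpace X] {κ : Kernel X X} {ρ ρ' : Measure X} (h : ρ ≤ ρ') :
    κ ∘ₘ ρ ≤ κ ∘ₘ ρ' := by
  refine Measure.le_iff.2 fun s hs => ?_
  rw [Measure.bind_apply hs κ.aemeasurable, Measure.bind_apply hs κ.aemeasurable]
  exact lintegral_mono' h le_rfl

section Minorization

variable {X : Type*} [MetricSpace X] [MeasurableSpace X] [BorelSpace X]

variable {μ : Measure X} {D E : Kernel X X} {T : X → X} {ε : ℝ≥0∞} {β : ℝ}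

/-- One step: moving by `E` to within `β` of `T y`, then diffusing by `D`. -/
lemma le_comp_of_diffusive (hD : ∀ x, ε • μ.restrict (Metric.ball x (2 * β)) ≤ D x)
    (y : X) {A : Set X} (hA : MeasurableSet A) :
    ε * μ (A ∩ Metric.ball (T y) β) * E y (Metric.ball (T y) β) ≤ (D ∘ₖ E) y A := by
  rw [Kernel.comp_apply' _ _ _ hA]
  refine le_lintegral_of_subset Metric.isOpen_ball.measurableSet fun x hx => ?_
  have h1 := hD x A
  rw [Measure.smul_apply, Measure.restrict_apply hA, smul_eq_mul] at h1
  refine le_trans ?_ h1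
  gcongr
  refine Metric.ball_subset_ball' ?_
  rw [dist_comm]
  linarith [Metric.mem_ball.1 hx]

/-- The law after `n + 1` steps charges every set that meets the ball around the noise-free
position in positive measure. -/
lemma pow_comp_ne_zero [μ.IsOpenPosMeasure] (hT : Continuous T) (hε : ε ≠ 0) (hβ : 0 < β)
    (hD : ∀ x, ε • μ.restrict (Metric.ball x (2 * β)) ≤ D x)
    (hE : ∀ y, E y (Metric.ball (T y) β) ≠ 0)
    (n : ℕ) (y : X) {A : Set X} (hA : MeasurableSet A)
    (h : μ (A ∩ Metric.ball (T^[n + 1] y) β) ≠ 0) :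
    ((D ∘ₖ E) ^ (n + 1)) y A ≠ 0 := by
  have hstep : ∀ (z : X) {B : Set X}, MeasurableSet B → μ (B ∩ Metric.ball (T z) β) ≠ 0 →
      (D ∘ₖ E) z B ≠ 0 := fun z B hB hz h0 => by
    have := le_comp_of_diffusive (T := T) (E := E) hD z hB
    rw [h0] at this
    exact mul_ne_zero (mul_ne_zero hε hz) (hE z) (le_antisymm this zero_le)
  induction n generalizing y with
  | zero => simpa using hstep y hA h
  | succ n ih =>
    rw [add_comm (n + 1) 1, Kernel.pow_add_apply_eq_lintegral _ _ _ _ hA, pow_one]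
    -- `Z` is open and contains `T y`, so the first step charges it; from each of its points the
    -- induction hypothesis covers the remaining `n + 1` steps.
    let Z : Set X := {z | μ (A ∩ Metric.ball (T^[n + 1] z) β) ≠ 0}
    have hZ : IsOpen Z :=
      (isOpen_setOf_measure_inter_ball_ne_zero μ A β).preimage (hT.iterate (n + 1))
    refine lintegral_ne_zero_of_subset (S := Z) (Kernel.measurable_coe _ hA)
      (hstep y hZ.measurableSet ?_) fun z hz => ih z hz
    refine ((hZ.inter Metric.isOpen_ball).measure_pos μ ⟨T y, ?_, Metric.mem_ball_self hβ⟩).ne'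
    exact h

/-- If the noise-free dynamics `T` converge to `x₀` from almost every point, if `E` charges every
neighbourhood of size `β` of `T`, and if `D` diffuses at scale `2 * β`, then some power of
`E ∘ₖ D` dominates a nonzero measure. -/
theorem exists_minorization [CompactSpace X] [IsFiniteMeasure μ] [μ.IsOpenPosMeasure]
    [IsMarkovKernel D] [IsMarkovKernel E]
    (hT : Continuous T) (hε : ε ≠ 0) (hβ : 0 < β)
    (hD : ∀ x, ε • μ.restrict (Metric.ball x (2 * β)) ≤ D x)
    (hE : ∀ y, E y (Metric.ball (T y) β) ≠ 0) {x₀ : X} (hx₀ : T x₀ = x₀)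
    (hconv : ∀ᵐ y ∂μ, Tendsto (fun n : ℕ => T^[n] y) atTop (𝓝 x₀)) :
    ∃ N : ℕ, N ≠ 0 ∧ ∃ ν : Measure X, ν Set.univ ≠ 0 ∧ ∀ x, ν ≤ ((E ∘ₖ D) ^ N) x := by
  let Q := D ∘ₖ E
  -- a set of states near `x₀` from which one step is uniformly diffusive
  obtain ⟨c, hc, S, hSm, hS0, hSU, hSQ⟩ : ∃ c : ℝ≥0∞, c ≠ 0 ∧ ∃ S : Set X, MeasurableSet S ∧
      μ S ≠ 0 ∧ S ⊆ Metric.ball x₀ (β / 2) ∧ ∀ y ∈ S, ∀ A, MeasurableSet A →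
        c * μ (A ∩ Metric.ball x₀ (β / 2)) ≤ Q y A := by
    let e : X → ℝ≥0∞ := fun y => E y (Metric.ball (T y) β)
    have he : Measurable e :=
      Kernel.measurable_kernel_prodMk_left (κ := E) (t := {q : X × X | dist q.2 (T q.1) < β})
        (isOpen_lt (by fun_prop) continuous_const).measurableSet
    let U : Set X := Metric.ball x₀ (β / 2) ∩ T ⁻¹' Metric.ball x₀ (β / 2)
    have hUo : IsOpen U := Metric.isOpen_ball.inter (Metric.isOpen_ball.preimage hT)
    have hU0 : μ U ≠ 0 := by
      refine (hUo.measure_pos μ ⟨x₀, Metric.mem_ball_self (by linarith), ?_⟩).ne'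
      rw [Set.mem_preimage, hx₀]
      exact Metric.mem_ball_self (by linarith)
    -- Positivity of `e` is only pointwise. Exhausting `U` by the sets where `e` exceeds `1 / k`
    -- gives a uniform bound on a set of positive measure.
    have hcov : U = ⋃ k : ℕ, U ∩ {y | ((k : ℝ≥0∞))⁻¹ < e y} := by
      rw [← Set.inter_iUnion, eq_comm, Set.inter_eq_left]
      intro y _
      obtain ⟨k, hk⟩ := ENNReal.exists_inv_nat_lt (hE y)
      exact Set.mem_iUnion.2 ⟨k, hk⟩
    obtain ⟨k, hk⟩ : ∃ k : ℕ, μ (U ∩ {y | ((k : ℝ≥0∞))⁻¹ < e y}) ≠ 0 := by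
      by_contra! hcon
      exact hU0 (by rw [hcov]; exact measure_iUnion_null hcon)
    refine ⟨ε * (k : ℝ≥0∞)⁻¹, mul_ne_zero hε (by simp), _,
      hUo.measurableSet.inter (measurableSet_lt measurable_const he), hk,
      fun y hy => hy.1.1, fun y hy A hA => ?_⟩
    refine le_trans ?_ (le_comp_of_diffusive (T := T) (E := E) hD y hA)
    rw [mul_right_comm]
    have h1 : Metric.ball x₀ (β / 2) ⊆ Metric.ball (T y) β := by
      refine Metric.ball_subset_ball' ?_
      rw [dist_comm]
      linarith [Metric.mem_ball.1 hy.1.2]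
    have h2 : (k : ℝ≥0∞)⁻¹ ≤ E y (Metric.ball (T y) β) := hy.2.le
    gcongr
  -- from every ball the set `S` is reached in all large numbers of steps
  have hreach : ∀ x : X, ∃ n : ℕ, ∀ m, n ≤ m →
      ∫⁻ y in Metric.ball x β, (Q ^ (m + 1)) y S ∂μ ≠ 0 := by
    intro x
    -- By almost sure convergence the sets `B n` (orbits near `x₀` from time `n` on) cover almost
    -- all of the ball, so one of them is not null there. Outer measure suffices: `B n` need not be
    -- measurable.
    let B : ℕ → Set X := fun n => {y | ∀ m, n ≤ m → T^[m] y ∈ Metric.ball x₀ (β / 2)}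
    obtain ⟨n, hn⟩ : ∃ n, (μ.restrict (Metric.ball x β)) (B n) ≠ 0 := by
      by_contra! hcon
      have h0 := measure_iUnion_null hcon
      have hall : ∀ᵐ y ∂(μ.restrict (Metric.ball x β)), y ∈ ⋃ n, B n := by
        filter_upwards [ae_restrict_of_ae hconv] with y hy
        obtain ⟨n, hn⟩ := eventually_atTop.1
          (hy.eventually (Metric.ball_mem_nhds x₀ (by linarith : 0 < β / 2)))
        exact Set.mem_iUnion.2 ⟨n, hn⟩
      have huniv : (μ.restrict (Metric.ball x β)) Set.univ = 0 := by
        refine measure_mono_null (t := (⋃ n, B n) ∪ (⋃ n, B n)ᶜ)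
          (by rw [Set.union_compl_self]) ?_
        exact measure_union_null h0 hall
      rw [Measure.restrict_apply_univ] at huniv
      exact (Metric.measure_ball_pos μ x hβ).ne' huniv
    refine ⟨n, fun m hm => lintegral_ne_zero_of_subset (Kernel.measurable_coe _ hSm) hn
      fun y hy => pow_comp_ne_zero hT hε hβ hD hE m y hSm ?_⟩
    rw [Set.inter_eq_left.2]
    · exact hS0
    · refine hSU.trans (Metric.ball_subset_ball' ?_)
      rw [dist_comm]
      linarith [Metric.mem_ball.1 (hy (m + 1) (by omega))]
  choose n hn using hreach
  obtain ⟨t, ht⟩ := isCompact_univ.elim_finite_subcover (fun x : X => Metric.ball x β)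
    (fun _ => Metric.isOpen_ball) fun x _ => Set.mem_iUnion.2 ⟨x, Metric.mem_ball_self hβ⟩
  -- Reaching `S` is possible at all large times, so the finite cover admits a common time `m`, and
  -- `δ` is the least of finitely many nonzero values.
  let m := t.sup n
  let δ : ℝ≥0∞ := t.inf fun x => ∫⁻ y in Metric.ball x β, (Q ^ (m + 1)) y S ∂μ
  have hδ : δ ≠ 0 := by
    refine (Finset.lt_inf_iff (by simp)).2 (fun x hx => ?_) |>.ne'
    exact pos_iff_ne_zero.2 (hn x m (Finset.le_sup hx))
  have hhit : ∀ x, ε * δ ≤ ((Q ^ (m + 1)) ∘ₖ D) x S := by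
    intro x
    obtain ⟨z, hz, hxz⟩ := Set.mem_iUnion₂.1 (ht (Set.mem_univ x))
    have hsub : Metric.ball z β ⊆ Metric.ball x (2 * β) := by
      refine Metric.ball_subset_ball' ?_
      rw [dist_comm]
      linarith [Metric.mem_ball.1 hxz]
    rw [Kernel.comp_apply' _ _ _ hSm]
    calc ε * δ ≤ ε * ∫⁻ y in Metric.ball z β, (Q ^ (m + 1)) y S ∂μ := by
          gcongr
          exact Finset.inf_le hz
      _ ≤ ε * ∫⁻ y in Metric.ball x (2 * β), (Q ^ (m + 1)) y S ∂μ := by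
          gcongr
      _ = ∫⁻ y, (Q ^ (m + 1)) y S ∂(ε • μ.restrict (Metric.ball x (2 * β))) := by
          rw [lintegral_smul_measure, smul_eq_mul]
      _ ≤ ∫⁻ y, (Q ^ (m + 1)) y S ∂(D x) := lintegral_mono' (hD x) le_rfl
  -- After an initial `D`, `m + 1` steps of `Q` reach `S` and one more spreads over the ball around
  -- `x₀`; a final `E` turns `Q ^ (m + 2) ∘ₖ D` into `(E ∘ₖ D) ^ (m + 3)`.
  refine ⟨m + 3, by omega,
    E ∘ₘ ((c * (ε * δ)) • μ.restrict (Metric.ball x₀ (β / 2))), ?_, fun x => ?_⟩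
  · rw [Measure.bind_apply MeasurableSet.univ E.aemeasurable]
    simp only [measure_univ, lintegral_const, one_mul, Measure.smul_apply, smul_eq_mul,
      Measure.restrict_apply_univ]
    exact mul_ne_zero (mul_ne_zero hc (mul_ne_zero hε hδ))
      (Metric.measure_ball_pos μ x₀ (by linarith)).ne'
  · rw [comp_pow_succ, Kernel.comp_apply]
    refine comp_measure_mono (Measure.le_iff.2 fun A hA => ?_)
    have : (Q ^ (m + 2)) ∘ₖ D = Q ∘ₖ ((Q ^ (m + 1)) ∘ₖ D) := by
      rw [pow_succ']
      exact mul_assoc Q (Q ^ (m + 1)) D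
    rw [this, Kernel.comp_apply' _ _ _ hA, Measure.smul_apply, Measure.restrict_apply hA,
      smul_eq_mul, mul_right_comm]
    refine le_trans ?_ (le_lintegral_of_subset hSm fun y hy => hSQ y hy A hA)
    gcongr
    exact hhit x

end Minorization

/-! ### The error chain as a Markov kernel -/

/-- The Markov kernel `x ↦ law of f (x, Z)`, where `Z` has law `ν`. -/
noncomputable def randomMapKernel {X Z Y : Type*} [MeasurableSpace X] [MeasurableSpace Z]
    [MeasurableSpace Y] (f : X × Z → Y) (hf : Measurable f) (ν : Measure Z) [SFinite ν] :
    Kernel X Y where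
  toFun x := ν.map fun z => f (x, z)
  measurable' := by
    refine Measure.measurable_of_measurable_coe _ fun s hs => ?_
    have h : (fun x => ν.map (fun z => f (x, z)) s) = fun x => ν (Prod.mk x ⁻¹' (f ⁻¹' s)) :=
      funext fun x => Measure.map_apply (hf.comp measurable_prodMk_left) hs
    rw [h]
    exact measurable_measure_prodMk_left (hf hs)

section RandomMap

variable {X Z Y : Type*} [MeasurableSpace X] [MeasurableSpace Z] [MeasurableSpace Y]
  {f : X × Z → Y} (hf : Measurable f) (ν : Measure Z)

lemma randomMapKernel_apply [SFinite ν] (x : X) {s : Set Y} (hs : MeasurableSet s) :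
    randomMapKernel f hf ν x s = ν {z | f (x, z) ∈ s} :=
  Measure.map_apply (hf.comp measurable_prodMk_left) hs

instance [IsProbabilityMeasure ν] : IsMarkovKernel (randomMapKernel f hf ν) :=
  ⟨fun _ => Measure.isProbabilityMeasure_map (hf.comp measurable_prodMk_left).aemeasurable⟩

lemma randomMapKernel_comp_measure [SFinite ν] (ρ : Measure X) [SFinite ρ] :
    randomMapKernel f hf ν ∘ₘ ρ = (ρ.prod ν).map f := by
  ext s hs
  rw [Measure.bind_apply hs (Kernel.aemeasurable _), Measure.map_apply hf hs,
    Measure.prod_apply (hf hs)]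
  exact lintegral_congr fun x => randomMapKernel_apply hf ν x hs

end RandomMap

/-- A Haar measure on a compact group is invariant under right translations. -/
lemma isMulRightInvariant_of_compactSpace {G : Type*} [Group G] [TopologicalSpace G]
    [IsTopologicalGroup G] [CompactSpace G] [MeasurableSpace G] [BorelSpace G]
    (μ : Measure G) [μ.IsHaarMeasure] : μ.IsMulRightInvariant := by
  refine ⟨fun g => ?_⟩
  have h := Measure.isMulInvariant_eq_smul_of_compactSpace (μ.map (· * g)) μ
  have hu := congrArg (fun ρ : Measure G => ρ Set.univ) h
  -- The translate is a multiple of `μ` with the same finite nonzero total mass, so the factor is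
  -- `1`.
  simp only [Measure.map_apply (measurable_mul_const g) MeasurableSet.univ, Set.preimage_univ,
    Measure.smul_apply, ENNReal.smul_def, smul_eq_mul] at hu
  have h1 : (Measure.haarScalarFactor (μ.map (· * g)) μ : ℝ≥0∞) = 1 := by
    have hμ0 : μ Set.univ ≠ 0 := (isOpen_univ.measure_pos μ Set.univ_nonempty).ne'
    have hμt : μ Set.univ ≠ ∞ := measure_ne_top _ _
    exact ((ENNReal.mul_left_inj hμ0 hμt).1 (by rw [one_mul]; exact hu)).symm
  rw [h, ENNReal.coe_eq_one.1 h1, one_smul]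

lemma errorStep_eq {G Y : Type*} [Group G] {p : ℕ} {h : G → EuclideanSpace ℝ (Fin p) → Y}
    {K : Y → G} (Υ w x : G) (v : EuclideanSpace ℝ (Fin p)) :
    errorStep h K Υ w v x = errorStep h K Υ 1 v (w * x) := by
  simp only [errorStep, mul_one, mul_assoc]

section ErrorChain

variable {G : Type*} [Group G] [MetricSpace G] [IsTopologicalGroup G] [CompactSpace G]
  [MeasurableSpace G] [BorelSpace G]
  {Y : Type*} [MeasurableSpace Y] {p : ℕ} {h : G → EuclideanSpace ℝ (Fin p) → Y} {K : Y → G}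

lemma measurable_errorStep (hh : Measurable (Function.uncurry h)) (hK : Measurable K) (Υ : G) :
    Measurable fun z : G × (G × EuclideanSpace ℝ (Fin p)) =>
      errorStep h K Υ z.2.1 z.2.2 z.1 := by
  have h1 : Measurable fun z : G × (G × EuclideanSpace ℝ (Fin p)) => Υ * z.2.1 * z.1 * Υ⁻¹ := by
    fun_prop
  have h2 : Measurable fun z : G × (G × EuclideanSpace ℝ (Fin p)) =>
      K (h (Υ * z.2.1 * z.1 * Υ⁻¹) z.2.2) :=
    hK.comp (hh.comp (h1.prodMk measurable_snd.snd))
  exact h1.mul h2.inv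

lemma measurable_update (hh : Measurable (Function.uncurry h)) (hK : Measurable K) (Υ : G) :
    Measurable fun z : G × EuclideanSpace ℝ (Fin p) => errorStep h K Υ 1 z.2 z.1 :=
  (measurable_errorStep hh hK Υ).comp
    (measurable_fst.prodMk (measurable_const.prodMk measurable_snd))

/-- The transition kernel of the error chain. -/
noncomputable def errorKernel (hh : Measurable (Function.uncurry h)) (hK : Measurable K) (Υ : G)
    (νW : Measure G) (νV : Measure (EuclideanSpace ℝ (Fin p))) [SFinite νW] [SFinite νV] :
    Kernel G G :=
  randomMapKernel _ (measurable_errorStep hh hK Υ) (νW.prod νV)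

lemma errorKernel_comp_measure (hh : Measurable (Function.uncurry h)) (hK : Measurable K) (Υ : G)
    (νW : Measure G) (νV : Measure (EuclideanSpace ℝ (Fin p))) [SFinite νW] [SFinite νV]
    (ρ : Measure G) [SFinite ρ] :
    errorKernel hh hK Υ νW νV ∘ₘ ρ = (ρ.prod (νW.prod νV)).map
      fun z : G × (G × EuclideanSpace ℝ (Fin p)) => errorStep h K Υ z.2.1 z.2.2 z.1 :=
  randomMapKernel_comp_measure _ _ _

lemma errorKernel_apply (hh : Measurable (Function.uncurry h)) (hK : Measurable K) (Υ : G)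
    (νW : Measure G) (νV : Measure (EuclideanSpace ℝ (Fin p))) [SFinite νW] [SFinite νV]
    (x : G) {s : Set G} (hs : MeasurableSet s) :
    errorKernel hh hK Υ νW νV x s = ∫⁻ w, νV {v | errorStep h K Υ w v x ∈ s} ∂νW := by
  have hm : Measurable fun z : G × EuclideanSpace ℝ (Fin p) => errorStep h K Υ z.1 z.2 x :=
    (measurable_errorStep hh hK Υ).comp measurable_prodMk_left
  rw [errorKernel, randomMapKernel_apply _ _ _ hs]
  exact Measure.prod_apply (hm hs)

/-- The error chain first diffuses by `W`, then applies the noisy update. -/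
lemma errorKernel_eq_comp (hh : Measurable (Function.uncurry h)) (hK : Measurable K) (Υ : G)
    (νW : Measure G) (νV : Measure (EuclideanSpace ℝ (Fin p))) [SFinite νW] [SFinite νV] :
    errorKernel hh hK Υ νW νV = randomMapKernel _ (measurable_update hh hK Υ) νV ∘ₖ
      randomMapKernel (fun z : G × G => z.2 * z.1) (by fun_prop) νW := by
  ext x s hs
  rw [Kernel.comp_apply' _ _ _ hs]
  change _ = ∫⁻ y, _ ∂(νW.map fun w => w * x)
  rw [lintegral_map (Kernel.measurable_coe _ hs) (measurable_mul_const x),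
    errorKernel_apply _ _ _ _ _ _ hs]
  refine lintegral_congr fun w => ?_
  rw [randomMapKernel_apply _ _ _ hs]
  simp only [← errorStep_eq]

/-- The error kernel satisfies a Doeblin condition. -/
lemma exists_errorKernel_minorization [IsIsometricSMul Gᵐᵒᵖ G] (μ : Measure G) [μ.IsHaarMeasure]
    (hh : Measurable (Function.uncurry h)) (hK : Measurable K) (hK_one : K (h 1 0) = 1)
    (hcont : Continuous fun g : G => K (h g 0)) (Υ : G)
    (νW : Measure G) [IsProbabilityMeasure νW]
    (νV : Measure (EuclideanSpace ℝ (Fin p))) [IsProbabilityMeasure νV]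
    (α : ℝ) (hα : 0 < α) (hdiff : Diffusive μ νW α) (hout : ReasonableOutputNoise h K νV α)
    (hconv : ∀ᵐ γ₀ ∂μ, Tendsto (fun n : ℕ => (errorStep h K Υ 1 0)^[n] γ₀) atTop (𝓝 1)) :
    ∃ N : ℕ, N ≠ 0 ∧ ∃ ν : Measure G, ν Set.univ ≠ 0 ∧
      ∀ x, ν ≤ ((errorKernel hh hK Υ νW νV) ^ N) x := by
  have := isMulRightInvariant_of_compactSpace μ
  obtain ⟨ε, hε, hdiff⟩ := hdiff
  rw [errorKernel_eq_comp]
  -- With `β = α / 2`, `2 * β` is the diffusivity radius and `β` the tolerance of the output noise.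
  refine exists_minorization (μ := μ) (T := errorStep h K Υ 1 0) (ε := ENNReal.ofReal ε)
    (β := α / 2) (x₀ := 1) ?_ (by simpa using hε) (by linarith) (fun x => ?_) (fun y => ?_) ?_ hconv
  · have h1 : Continuous fun x : G => Υ * 1 * x * Υ⁻¹ := by fun_prop
    exact h1.mul (hcont.comp h1).inv
  · refine Measure.le_iff.2 fun A hA => ?_
    rw [randomMapKernel_apply _ _ _ hA, Measure.smul_apply, Measure.restrict_apply hA, smul_eq_mul,
      mul_div_cancel₀ α two_ne_zero]
    have hB : MeasurableSet (A ∩ Metric.ball x α) := hA.inter Metric.isOpen_ball.measurableSet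
    have hUm : MeasurableSet ((fun w => w * x) ⁻¹' (A ∩ Metric.ball x α)) :=
      measurable_mul_const x hB
    -- Right invariance of the distance carries the diffusivity at `1` to every `x`; right
    -- invariance of `μ` preserves the mass.
    have hsub : (fun w => w * x) ⁻¹' (A ∩ Metric.ball x α) ⊆ Metric.ball 1 α := fun w hw => by
      have h2 : dist (w * x) x < α := hw.2
      rw [Metric.mem_ball]
      rwa [← dist_mul_right w 1 x, one_mul]
    have h1 := hdiff _ hUm hsub
    calc ENNReal.ofReal ε * μ (A ∩ Metric.ball x α)
        = ENNReal.ofReal (ε * μ.real ((fun w => w * x) ⁻¹' (A ∩ Metric.ball x α))) := by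
          rw [ENNReal.ofReal_mul hε.le, ofReal_measureReal, measure_preimage_mul_right]
      _ ≤ ENNReal.ofReal (νW.real ((fun w => w * x) ⁻¹' (A ∩ Metric.ball x α))) :=
          ENNReal.ofReal_le_ofReal h1
      _ = νW ((fun w => w * x) ⁻¹' (A ∩ Metric.ball x α)) := ofReal_measureReal
      _ ≤ νW {w | w * x ∈ A} := measure_mono fun w hw => hw.1
  · obtain ⟨ε', hε', hlt⟩ := hout (Υ * 1 * y * Υ⁻¹)
    rw [randomMapKernel_apply _ _ _ Metric.isOpen_ball.measurableSet]
    intro h0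
    have : νV.real {v | errorStep h K Υ 1 v y ∈ Metric.ball (errorStep h K Υ 1 0 y) (α / 2)} = 0 :=
      by rw [Measure.real, h0, ENNReal.toReal_zero]
    exact absurd (hε'.trans hlt) (by
      change ¬ 0 < νV.real
        {v | errorStep h K Υ 1 v y ∈ Metric.ball (errorStep h K Υ 1 0 y) (α / 2)}
      rw [this]
      exact lt_irrefl 0)
  · simp [errorStep, hK_one]

end ErrorChain

/-! ### Runs of the filter and the law of their error -/

/-- If `A` is independent of `(B, C)` and `B` is independent of `C`, then `(A, B)` is independent
of `C`. -/
lemma indepFun_prodMk_of_indepFun {S A B C : Type*} [MeasurableSpace S]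
    {P : Measure S} [IsProbabilityMeasure P] [MeasurableSpace A] [MeasurableSpace B]
    [MeasurableSpace C] {a : S → A} {b : S → B} {c : S → C} (ha : Measurable a) (hb : Measurable b)
    (hc : Measurable c) (h1 : IndepFun a (fun s => (b s, c s)) P) (h2 : IndepFun b c P) :
    IndepFun (fun s => (a s, b s)) c P := by
  have hab : IndepFun a b P := h1.comp measurable_id measurable_fst
  have pa := Measure.isProbabilityMeasure_map (μ := P) ha.aemeasurable
  have pb := Measure.isProbabilityMeasure_map (μ := P) hb.aemeasurable
  have pc := Measure.isProbabilityMeasure_map (μ := P) hc.aemeasurable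
  rw [indepFun_iff_map_prod_eq_prod_map_map (ha.prodMk hb).aemeasurable hc.aemeasurable,
    (indepFun_iff_map_prod_eq_prod_map_map ha.aemeasurable hb.aemeasurable).1 hab,
    ← (measurePreserving_prodAssoc (P.map a) (P.map b) (P.map c)).symm.map_eq,
    ← (indepFun_iff_map_prod_eq_prod_map_map hb.aemeasurable hc.aemeasurable).1 h2,
    ← (indepFun_iff_map_prod_eq_prod_map_map ha.aemeasurable (hb.prodMk hc).aemeasurable).1 h1,
    Measure.map_map (MeasurableEquiv.measurable _) (ha.prodMk (hb.prodMk hc))]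
  rfl

section FilterRun

variable {G : Type*} [Group G] [MeasurableSpace G] {Y : Type*} [MulAction G Y]
  {p : ℕ} {h : G → EuclideanSpace ℝ (Fin p) → Y} {K : Y → G} {Υ : G} {Ωin : ℕ → G}
  {νW : Measure G} {νV : Measure (EuclideanSpace ℝ (Fin p))}
  {S : Type*} [MeasurableSpace S] {P : Measure S}
  {W : ℕ → S → G} {V : ℕ → S → EuclideanSpace ℝ (Fin p)}
  {χ : ℕ → S → G} {Yobs : ℕ → S → Y} {χpred χhat : ℕ → S → G}

/-- One step of the pair (state, estimate), with input `ω` and noises `q = (w, v)`. -/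
def pairStep (h : G → EuclideanSpace ℝ (Fin p) → Y) (K : Y → G) (Υ ω : G)
    (z : (G × G) × (G × EuclideanSpace ℝ (Fin p))) : G × G :=
  (Υ * z.2.1 * z.1.1 * ω,
    K ((Υ * z.1.2 * ω) • h (Υ * z.2.1 * z.1.1 * ω) z.2.2) * (Υ * z.1.2 * ω))

lemma IsFilterRun.pair_succ
    (hrun : IsFilterRun h K Υ Ωin νW νV P W V χ Yobs χpred χhat) (n : ℕ) (s : S) :
    (χ (n + 1) s, χhat (n + 1) s) =
      pairStep h K Υ (Ωin n) ((χ n s, χhat n s), (W n s, V (n + 1) s)) := by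
  simp only [pairStep, hrun.update_eq, hrun.output_eq, hrun.prediction_eq, hrun.state_eq]

variable [MetricSpace G] [IsTopologicalGroup G] [CompactSpace G] [BorelSpace G]
  [MeasurableSpace Y] [MeasurableSMul₂ G Y]

lemma measurable_pairStep (hh : Measurable (Function.uncurry h)) (hK : Measurable K) (Υ ω : G) :
    Measurable (pairStep h K Υ ω) := by
  have h1 : Measurable fun z : (G × G) × (G × EuclideanSpace ℝ (Fin p)) =>
      Υ * z.2.1 * z.1.1 * ω := by fun_prop
  have h2 : Measurable fun z : (G × G) × (G × EuclideanSpace ℝ (Fin p)) =>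
      Υ * z.1.2 * ω := by fun_prop
  exact h1.prodMk ((hK.comp (h2.smul (hh.comp (h1.prodMk measurable_snd.snd)))).mul h2)

/-- By equivariance, the error after one step of the pair has the law of one step of the error
chain. -/
lemma map_pairStep_error (hh : Measurable (Function.uncurry h)) (hK : Measurable K)
    [IsProbabilityMeasure νW] [IsProbabilityMeasure νV] (hequiv : LeftRightEquivariant h νV)
    (Υ ω : G) (ρ : Measure (G × G)) [IsProbabilityMeasure ρ] :
    (ρ.prod (νW.prod νV)).map (fun z => (pairStep h K Υ ω z).1 * ((pairStep h K Υ ω z).2)⁻¹) =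
      errorKernel hh hK Υ νW νV ∘ₘ ρ.map fun q => q.1 * q.2⁻¹ := by
  have hd : Measurable fun q : G × G => q.1 * q.2⁻¹ := by fun_prop
  have hl : Measurable fun z : (G × G) × (G × EuclideanSpace ℝ (Fin p)) =>
      (pairStep h K Υ ω z).1 * ((pairStep h K Υ ω z).2)⁻¹ :=
    hd.comp (measurable_pairStep hh hK Υ ω)
  ext s hs
  rw [Measure.bind_apply hs (Kernel.aemeasurable _),
    lintegral_map (Kernel.measurable_coe _ hs) hd, Measure.map_apply hl hs,
    Measure.prod_apply (hl hs)]
  refine lintegral_congr fun q => ?_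
  rw [errorKernel_apply _ _ _ _ _ _ hs, Measure.prod_apply (measurable_prodMk_left (hl hs))]
  refine lintegral_congr fun w => ?_
  -- Equivariance is used with `g` the inverse of the predicted estimate: `χ * g` is then the
  -- predicted error, in which `ω` cancels, and `g⁻¹ • h χ v` is the argument of the gain `K`.
  have he := (hequiv (Υ * q.2 * ω)⁻¹ (Υ * w * q.1 * ω)).1
  have hz : Υ * w * q.1 * ω * (Υ * q.2 * ω)⁻¹ = Υ * w * (q.1 * q.2⁻¹) * Υ⁻¹ := by group
  rw [hz, inv_inv] at he
  have hm1 : Measurable fun v => h (Υ * w * (q.1 * q.2⁻¹) * Υ⁻¹) v :=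
    hh.comp measurable_prodMk_left
  have hm2 : Measurable fun v => (Υ * q.2 * ω) • h (Υ * w * q.1 * ω) v :=
    (hh.comp measurable_prodMk_left).const_smul _
  -- The updated error is a function of that argument alone once `w` and the pair are fixed, so
  -- equality of the two laws is tested on this set.
  have hS : MeasurableSet {y : Y | Υ * w * (q.1 * q.2⁻¹) * Υ⁻¹ * (K y)⁻¹ ∈ s} :=
    (hK.inv.const_mul _) hs
  have := congrArg (fun θ : Measure Y => θ {y | Υ * w * (q.1 * q.2⁻¹) * Υ⁻¹ * (K y)⁻¹ ∈ s}) he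
  simp only [Measure.map_apply hm1 hS, Measure.map_apply hm2 hS] at this
  refine Eq.trans (congrArg νV ?_) this.symm
  ext v
  simp only [Set.mem_preimage, Set.mem_ofPred_eq, pairStep, mul_inv_rev, mul_assoc,
    mul_inv_cancel_left]

/-- The pair (state, estimate) at time `n` is a measurable function of the initial pair and of
the noises up to time `n`. -/
lemma IsFilterRun.exists_pair_eq (hh : Measurable (Function.uncurry h)) (hK : Measurable K)
    (hrun : IsFilterRun h K Υ Ωin νW νV P W V χ Yobs χpred χhat) (n : ℕ) :
    ∃ Φ : (G × G) × (Finset.range n → G × EuclideanSpace ℝ (Fin p)) → G × G, Measurable Φ ∧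
      ∀ s, (χ n s, χhat n s) =
        Φ ((χ 0 s, χhat 0 s), fun k => (W k s, V (k + 1) s)) := by
  induction n with
  | zero => exact ⟨Prod.fst, measurable_fst, fun s => rfl⟩
  | succ n ih =>
    obtain ⟨Φ, hΦ, hΦe⟩ := ih
    let res : (Finset.range (n + 1) → G × EuclideanSpace ℝ (Fin p)) →
        Finset.range n → G × EuclideanSpace ℝ (Fin p) :=
      fun f k => f ⟨k, Finset.mem_range.2 ((Finset.mem_range.1 k.2).trans (Nat.lt_succ_self n))⟩
    have hres : Measurable res := measurable_pi_lambda _ fun k => measurable_pi_apply _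
    refine ⟨fun z => pairStep h K Υ (Ωin n)
      (Φ (z.1, res z.2), z.2 ⟨n, Finset.self_mem_range_succ n⟩), ?_, fun s => ?_⟩
    · exact (measurable_pairStep hh hK Υ (Ωin n)).comp
        ((hΦ.comp (measurable_fst.prodMk (hres.comp measurable_snd))).prodMk
          ((measurable_pi_apply _).comp measurable_snd))
    · rw [hrun.pair_succ, hΦe]

lemma IsFilterRun.measurable_pair (hh : Measurable (Function.uncurry h)) (hK : Measurable K)
    (hrun : IsFilterRun h K Υ Ωin νW νV P W V χ Yobs χpred χhat) (n : ℕ) :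
    Measurable fun s => (χ n s, χhat n s) := by
  obtain ⟨Φ, hΦ, hΦe⟩ := hrun.exists_pair_eq hh hK n
  simp_rw [hΦe]
  exact hΦ.comp ((hrun.measurable_state.prodMk hrun.measurable_estimate).prodMk
    (measurable_pi_lambda _ fun k => (hrun.measurable_W k).prodMk (hrun.measurable_V _)))

variable [IsProbabilityMeasure P]

/-- The pair at time `n` only involves the initial pair and the noises of index below `n`; those are
jointly independent of the noise of index `n`. This gives the Markov property of the error laws. -/
lemma IsFilterRun.indepFun_pair (hh : Measurable (Function.uncurry h)) (hK : Measurable K)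
    (hrun : IsFilterRun h K Υ Ωin νW νV P W V χ Yobs χpred χhat) (n : ℕ) :
    IndepFun (fun s => (χ n s, χhat n s)) (fun s => (W n s, V (n + 1) s)) P := by
  have hN : ∀ k, Measurable fun s => (W k s, V (k + 1) s) := fun k =>
    (hrun.measurable_W k).prodMk (hrun.measurable_V _)
  obtain ⟨Φ, hΦ, hΦe⟩ := hrun.exists_pair_eq hh hK n
  have h2 := hrun.noise_indep.indepFun_finset (Finset.range n) {n} (by simp) hN
  have h2' : IndepFun (fun s (k : Finset.range n) => (W k s, V (k + 1) s))
      (fun s => (W n s, V (n + 1) s)) P :=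
    h2.comp (φ := id)
      (ψ := fun f : ({n} : Finset ℕ) → G × EuclideanSpace ℝ (Fin p) =>
        f ⟨n, Finset.mem_singleton_self n⟩) measurable_id (measurable_pi_apply _)
  have hpi : Measurable fun f : ℕ → G × EuclideanSpace ℝ (Fin p) =>
      ((fun k : Finset.range n => f k), f n) :=
    (measurable_pi_lambda _ fun k => measurable_pi_apply _).prodMk (measurable_pi_apply _)
  have h1 : IndepFun (fun s => (χ 0 s, χhat 0 s)) (fun s =>
      ((fun k : Finset.range n => (W k s, V (k + 1) s)), (W n s, V (n + 1) s))) P :=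
    hrun.init_indep.comp measurable_id hpi
  have h3 := indepFun_prodMk_of_indepFun
    (hrun.measurable_state.prodMk hrun.measurable_estimate)
    (measurable_pi_lambda _ fun k : Finset.range n => hN k) (hN n) h1 h2'
  simp_rw [hΦe]
  exact h3.comp hΦ measurable_id

/-- The laws of the error along a run follow the error kernel. -/
lemma IsFilterRun.map_error_succ (hh : Measurable (Function.uncurry h)) (hK : Measurable K)
    [IsProbabilityMeasure νW] [IsProbabilityMeasure νV] (hequiv : LeftRightEquivariant h νV)
    (hrun : IsFilterRun h K Υ Ωin νW νV P W V χ Yobs χpred χhat) (n : ℕ) :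
    (P.map fun s => χ (n + 1) s * (χhat (n + 1) s)⁻¹) =
      errorKernel hh hK Υ νW νV ∘ₘ P.map fun s => χ n s * (χhat n s)⁻¹ := by
  have hd : Measurable fun q : G × G => q.1 * q.2⁻¹ := by fun_prop
  have hp := hrun.measurable_pair hh hK n
  have hN : Measurable fun s => (W n s, V (n + 1) s) :=
    (hrun.measurable_W n).prodMk (hrun.measurable_V _)
  have pp := Measure.isProbabilityMeasure_map (μ := P) hp.aemeasurable
  have hjoint := (indepFun_iff_map_prod_eq_prod_map_map hp.aemeasurable hN.aemeasurable).1
    (hrun.indepFun_pair hh hK n)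
  rw [hrun.noise_law] at hjoint
  have key := map_pairStep_error (νW := νW) hh hK hequiv Υ (Ωin n)
    (P.map fun s => (χ n s, χhat n s))
  have hl : Measurable fun z => (pairStep h K Υ (Ωin n) z).1 * ((pairStep h K Υ (Ωin n) z).2)⁻¹ :=
    hd.comp (measurable_pairStep hh hK Υ (Ωin n))
  rw [← hjoint, Measure.map_map hd hp, Measure.map_map hl (hp.prodMk hN)] at key
  refine Eq.trans ?_ key
  congr 1
  ext s
  simp only [Function.comp, ← hrun.pair_succ]

end FilterRun

end InvariantFilter

/-! ### Convergence of the filter error -/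

theorem mainTheorem11
    {G : Type*} [Group G] [MetricSpace G] [IsTopologicalGroup G] [CompactSpace G]
    [IsIsometricSMul Gᵐᵒᵖ G] [MeasurableSpace G] [BorelSpace G]
    (μ : Measure G) [μ.IsHaarMeasure]
    {Y : Type*} [MeasurableSpace Y] [MulAction G Y] [MeasurableSMul₂ G Y]
    {p : ℕ} (h : G → EuclideanSpace ℝ (Fin p) → Y) (hh : Measurable (Function.uncurry h))
    (K : Y → G) (hK : Measurable K) (hK_one : K (h 1 0) = 1)
    (hcont : Continuous fun g : G => K (h g 0))
    (Υ : G)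
    (νW : Measure G) [IsProbabilityMeasure νW]
    (νV : Measure (EuclideanSpace ℝ (Fin p))) [IsProbabilityMeasure νV]
    (hequiv : InvariantFilter.LeftRightEquivariant h νV)
    (α : ℝ) (hα : 0 < α)
    (hdiff : InvariantFilter.Diffusive μ νW α)
    (hout : InvariantFilter.ReasonableOutputNoise h K νV α)
    (hconv : ∀ᵐ γ₀ ∂μ,
      Tendsto (fun n : ℕ => (InvariantFilter.errorStep h K Υ 1 0)^[n] γ₀) atTop (𝓝 1)) :
    ∃ π : Measure G, ∃ _ : IsProbabilityMeasure π,
      InvariantFilter.IsStationary h K Υ νW νV π ∧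
      (∀ π' : Measure G, IsProbabilityMeasure π' →
        InvariantFilter.IsStationary h K Υ νW νV π' → π' = π) ∧
      ∀ (S : Type*) [MeasurableSpace S] (P : Measure S) [IsProbabilityMeasure P]
        (Ωin : ℕ → G) (W : ℕ → S → G) (V : ℕ → S → EuclideanSpace ℝ (Fin p))
        (χ : ℕ → S → G) (Yobs : ℕ → S → Y) (χpred χhat : ℕ → S → G),
        InvariantFilter.IsFilterRun h K Υ Ωin νW νV P W V χ Yobs χpred χhat →
        Tendsto (fun n : ℕ =>
          InvariantFilter.tvNorm (P.map fun s => χ n s * (χhat n s)⁻¹) π) atTop (𝓝 0) := by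
  open InvariantFilter in
  obtain ⟨N, hN, ν, hν0, hν⟩ := exists_errorKernel_minorization μ hh hK hK_one hcont Υ νW νV α hα
    hdiff hout hconv
  have hM : IsMarkovKernel (errorKernel hh hK Υ νW νV) := by
    unfold errorKernel
    infer_instance
  have hMN := isMarkovKernel_pow (errorKernel hh hK Υ νW νV) N
  -- A measure dominated by a probability law has mass at most `1`; any starting point serves, here
  -- `1`.
  have hν1 : ν Set.univ ≤ 1 := (hν 1 Set.univ).trans_eq measure_univ
  have hνf : IsFiniteMeasure ν := ⟨hν1.trans_lt ENNReal.one_lt_top⟩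
  obtain ⟨π, hπ, hinv, huniq, hlim⟩ := doeblin (errorKernel hh hK Υ νW νV) hN ν hν hν0 hν1
  refine ⟨π, hπ, ?_, fun π' h1 h2 => huniq π' h1 ?_, ?_⟩
  · rw [errorKernel_comp_measure] at hinv
    exact hinv
  · rw [errorKernel_comp_measure]
    exact h2
  · intro S _ P _ Ωin W V χ Yobs χpred χhat hrun
    have hd : Measurable fun q : G × G => q.1 * q.2⁻¹ := by fun_prop
    have hprob : ∀ n, IsProbabilityMeasure (P.map fun s => χ n s * (χhat n s)⁻¹) := fun n =>
      Measure.isProbabilityMeasure_map (hd.comp (hrun.measurable_pair hh hK n)).aemeasurable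
    exact hlim _ fun n => hrun.map_error_succ hh hK hequiv n
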